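/- Let $\sigma_0=\mathbb{I}$ and $\sigma_1=\begin{pmatrix}0&1\\1&0\end{pmatrix}$, $\sigma_2=\begin{pmatrix}0&-i\\i&0\end{pmatrix}$, $\sigma_3=\begin{pmatrix}1&0\\0&-1\end{pmatrix}$ be the $2\times 2$ identity matrix and the Pauli matrices. Let $\mathbf{L}$ be the set of all unitaries $U$ on $\mathbb{C}^2\otimes\mathbb{C}^2$ for which there exist a unitary $R$ on $\mathbb{C}^2$ and unitaries $T_j,V_j$ on $\mathbb{C}^2$ such that $$U\,(R\sigma_jR^\dagger\otimes\mathbb{I})\,U^\dagger=T_j\otimes V_j\qquad\text{for } j=1,2,3.$$ Let $\mathcal{P}_2=\{c\,\sigma_j\otimes\sigma_k : 0\le j,k\le 3,\ c\in\{\pm1,\pm i\}\}$ be the two-qubit Pauli group and let $\mathcal{C}_2=\{U \text{ unitary on } \mathbb{C}^2\otimes\mathbb{C}^2 : UgU^\dagger\in\mathcal{P}_2 \text{ for all } g\in\mathcal{P}_2\}$ be the two-qubit Clifford group. Then a unitary $U$ on $\mathbb{C}^2\otimes\mathbb{C}^2$ belongs to $\mathbf{L}$ if and only if it is locally equivalent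 to an element of $\mathcal{C}_2$, that is, if and only if there exist unitaries $R_1,S_1,R_2,S_2$ on $\mathbb{C}^2$ such that $(R_1\otimes S_1)\,U\,(R_2\otimes S_2)\in\mathcal{C}_2$. -/

import Mathlib

open scoped Kronecker

/-- Operators on one qubit, as matrices in the computational basis. -/
abbrev OneQubitOp : Type := Matrix (Fin 2) (Fin 2) ℂ

/-- Operators on two qubits; the basis vector `|a⟩|b⟩` is indexed by the pair `(a, b)`. -/
abbrev TwoQubitOp : Type := Matrix (Fin 2 × Fin 2) (Fin 2 × Fin 2) ℂ

/-- The Pauli matrices `σ₀ = 𝕀, σ₁, σ₂, σ₃`. -/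
noncomputable def pauli : Fin 4 → OneQubitOp :=
  ![!![1, 0; 0, 1],
    !![0, 1; 1, 0],
    !![0, -Complex.I; Complex.I, 0],
    !![1, 0; 0, -1]]

/-- The family `L` of two-qubit unitaries `U` for which there is a one-qubit unitary `R` such that
`U (R σ_j R† ⊗ 𝕀) U†` is a product unitary `T_j ⊗ V_j` for each `j = 1, 2, 3`. -/
def familyL : Set TwoQubitOp :=
  {U | U ∈ Matrix.unitaryGroup (Fin 2 × Fin 2) ℂ ∧
    ∃ R ∈ Matrix.unitaryGroup (Fin 2) ℂ, ∀ j : Fin 4, j ≠ 0 →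
      ∃ T ∈ Matrix.unitaryGroup (Fin 2) ℂ, ∃ V ∈ Matrix.unitaryGroup (Fin 2) ℂ,
        U * ((R * pauli j * star R) ⊗ₖ (1 : OneQubitOp)) * star U = T ⊗ₖ V}

/-- The two-qubit Pauli group: `σ_j ⊗ σ_k` for `j, k = 0, …, 3`, times a phase `±1` or `±i`. -/
def pauliGroupTwo : Set TwoQubitOp :=
  {g | ∃ c ∈ ({1, -1, Complex.I, -Complex.I} : Set ℂ), ∃ j k : Fin 4,
    g = c • (pauli j ⊗ₖ pauli k)}

/-- The two-qubit Clifford group: the unitaries that conjugate the Pauli group into itself. -/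
def cliffordGroupTwo : Set TwoQubitOp :=
  {U | U ∈ Matrix.unitaryGroup (Fin 2 × Fin 2) ℂ ∧
    ∀ g ∈ pauliGroupTwo, U * g * star U ∈ pauliGroupTwo}

/-- `U` and `V` are locally equivalent: `V = (R₁ ⊗ S₁) U (R₂ ⊗ S₂)` for one-qubit unitaries
`R₁, S₁, R₂, S₂`. -/
def LocallyEquivalent (U V : TwoQubitOp) : Prop :=
  ∃ R₁ ∈ Matrix.unitaryGroup (Fin 2) ℂ, ∃ S₁ ∈ Matrix.unitaryGroup (Fin 2) ℂ,
    ∃ R₂ ∈ Matrix.unitaryGroup (Fin 2) ℂ, ∃ S₂ ∈ Matrix.unitaryGroup (Fin 2) ℂ,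
      V = (R₁ ⊗ₖ S₁) * U * (R₂ ⊗ₖ S₂)

/-! ### Local equivalence of the family `L` and the two-qubit Clifford group -/

/-! From `L` to Clifford, only the images of `σ₁ ⊗ 1` and `σ₃ ⊗ 1` matter, since `σ₂` is a multiple
of `σ₁σ₃`. Absorb `R` into `U`. The two images are products that square to one, so their factors can
be rescaled to involutions; since the images anticommute, exactly one tensor side anticommutes
(`commute_or_anticommute_factors`). A swap, which is Clifford and permutes local unitaries, makes it
the first side.

The anticommuting pair then rotates to `σ₁, σ₃`, and the commuting pair diagonalises to `±1` or
`±σ₃`. Both images are now Paulis up to sign. Two anticommuting Paulis commuting with both images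
pull back into the commutant of the first qubit, hence to `1 ⊗ A` and `1 ⊗ B`. Rotating the second
input qubit turns `A, B` into `σ₁, σ₃`, so all four generators have Pauli images
(`exists_mul_one_kronecker_mem_cliffordGroupTwo`).

Conversely, a Clifford operator sends `σ_j ⊗ 1` to a product, and local unitaries preserve products.
-/

/-! ### Normal forms of one-qubit unitary involutions -/

section Involutions

open Matrix
open scoped ComplexOrder

/-- A one-qubit involution other than minus the identity fixes a vector of norm one. -/
theorem exists_unit_fixed_vector {W : OneQubitOp} (hs : W * W = 1) (hne : W ≠ -1) :
    ∃ v : Fin 2 → ℂ, star v ⬝ᵥ v = 1 ∧ W *ᵥ v = v := by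
  -- Since `W(1 + W) = 1 + W`, every vector in the range of `1 + W` is fixed by `W`.
  obtain ⟨x, hx⟩ : ∃ x, (1 + W) *ᵥ x ≠ 0 := by
    by_contra! h
    apply hne
    have : 1 + W = 0 := by
      ext i j
      have := congrFun (h (Pi.single j 1)) i
      simpa using this
    exact eq_neg_of_add_eq_zero_right this
  set u := (1 + W) *ᵥ x with hu
  have hWu : W *ᵥ u = u := by
    rw [hu, mulVec_mulVec, mul_add, mul_one, hs, add_comm]
  have hpos : 0 < star u ⬝ᵥ u := dotProduct_star_self_pos_iff.2 hx
  obtain ⟨hre, him⟩ := Complex.lt_def.1 hpos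
  set r := (star u ⬝ᵥ u).re with hr
  have huu : star u ⬝ᵥ u = (r : ℂ) := by
    apply Complex.ext <;> simp [hr]
    simpa using him.symm
  have hr0 : 0 < r := by simpa using hre
  refine ⟨((Real.sqrt r)⁻¹ : ℂ) • u, ?_, ?_⟩
  · rw [star_smul, smul_dotProduct, dotProduct_smul, huu]
    have h1 : (Real.sqrt r : ℂ) * Real.sqrt r = r := by
      exact_mod_cast Real.mul_self_sqrt hr0.le
    have h2 : (Real.sqrt r : ℂ) ≠ 0 := by
      exact_mod_cast (Real.sqrt_pos.2 hr0).ne'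
    simp only [star_inv₀, Complex.star_def, Complex.conj_ofReal, smul_eq_mul]
    rw [← h1]
    field_simp
  · rw [mulVec_smul, hWu]

theorem star_eq_self_of_mul_self_eq_one {n : Type*} [Fintype n] [DecidableEq n]
    {W : Matrix n n ℂ} (hW : W ∈ unitaryGroup n ℂ) (hs : W * W = 1) : star W = W := by
  calc star W = star W * (W * W) := by rw [hs, mul_one]
    _ = W := by rw [← mul_assoc, mem_unitaryGroup_iff'.1 hW, one_mul]

/-- The matrix with columns `v` and `w`. -/
def twoColumns (v w : Fin 2 → ℂ) : OneQubitOp := (Matrix.of ![v, w])ᵀ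

theorem mul_twoColumns (W : OneQubitOp) (v w : Fin 2 → ℂ) :
    W * twoColumns v w = twoColumns (W *ᵥ v) (W *ᵥ w) := by
  ext i j
  fin_cases i <;> fin_cases j <;> simp [twoColumns, mul_apply]

theorem twoColumns_mul_pauli_three (v w : Fin 2 → ℂ) :
    twoColumns v w * pauli 3 = twoColumns v (-w) := by
  ext i j
  fin_cases j <;> simp [twoColumns, mul_apply, pauli]

theorem twoColumns_mul_pauli_one (v w : Fin 2 → ℂ) :
    twoColumns v w * pauli 1 = twoColumns w v := by
  ext i j
  fin_cases j <;> simp [twoColumns, mul_apply, pauli]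

theorem dotProduct_eq_zero_of_eigen {W : OneQubitOp} (hW : star W = W) {v w : Fin 2 → ℂ}
    (hv : W *ᵥ v = v) (hw : W *ᵥ w = -w) : star v ⬝ᵥ w = 0 := by
  have h : star v ⬝ᵥ w = -(star v ⬝ᵥ w) := by
    calc star v ⬝ᵥ w = star (W *ᵥ v) ⬝ᵥ w := by rw [hv]
      _ = star v ⬝ᵥ (W *ᵥ w) := by
        rw [star_mulVec, ← star_eq_conjTranspose, hW, ← dotProduct_mulVec]
      _ = -(star v ⬝ᵥ w) := by rw [hw, dotProduct_neg]
  exact self_eq_neg.1 h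

theorem twoColumns_mem_unitaryGroup {v w : Fin 2 → ℂ} (hv : star v ⬝ᵥ v = 1)
    (hw : star w ⬝ᵥ w = 1) (hvw : star v ⬝ᵥ w = 0) :
    twoColumns v w ∈ unitaryGroup (Fin 2) ℂ := by
  have hwv : star w ⬝ᵥ v = 0 := by
    rw [star_dotProduct, hvw, star_zero]
  rw [mem_unitaryGroup_iff']
  simp only [dotProduct, Fin.sum_univ_two, Pi.star_apply] at hv hw hvw hwv
  ext i j
  fin_cases i <;> fin_cases j <;> simp [twoColumns, mul_apply, star_apply] <;> assumption

theorem eq_conj_of_mul_eq {n : Type*} [Fintype n] [DecidableEq n] {S A B : Matrix n n ℂ}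
    (hS : S ∈ unitaryGroup n ℂ) (h : A * S = S * B) : A = S * B * star S := by
  rw [← h, mul_assoc, mem_unitaryGroup_iff.1 hS, mul_one]

/-- Unit fixed vectors of `W` and of `-W` are orthogonal because `W` is Hermitian; they are the
columns of `S`. -/
theorem exists_conj_pauli_three {W : OneQubitOp} (hW : W ∈ unitaryGroup (Fin 2) ℂ)
    (hs : W * W = 1) (h1 : W ≠ 1) (h2 : W ≠ -1) :
    ∃ S ∈ unitaryGroup (Fin 2) ℂ, W = S * pauli 3 * star S := by
  obtain ⟨v, hv, hWv⟩ := exists_unit_fixed_vector hs h2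
  obtain ⟨w, hw, hWw⟩ := exists_unit_fixed_vector (W := -W) (by simpa using hs)
    (fun h => h1 (neg_injective h))
  have hWw' : W *ᵥ w = -w := by
    rw [neg_mulVec] at hWw
    rw [← hWw, neg_neg, hWw]
  have hS := twoColumns_mem_unitaryGroup hv hw
    (dotProduct_eq_zero_of_eigen (star_eq_self_of_mul_self_eq_one hW hs) hWv hWw')
  refine ⟨_, hS, eq_conj_of_mul_eq hS ?_⟩
  rw [mul_twoColumns, twoColumns_mul_pauli_three, hWv, hWw']

/-- Two anticommuting unitary involutions on one qubit are simultaneously conjugate to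
`σ₃` and `σ₁`. -/
theorem exists_conj_pauli_pair {X Z : OneQubitOp} (hX : X ∈ unitaryGroup (Fin 2) ℂ)
    (hZ : Z ∈ unitaryGroup (Fin 2) ℂ) (hXs : X * X = 1) (hZs : Z * Z = 1)
    (hXZ : X * Z = -(Z * X)) :
    ∃ S ∈ unitaryGroup (Fin 2) ℂ, X = S * pauli 1 * star S ∧ Z = S * pauli 3 * star S := by
  have hne : Z ≠ -1 := by
    rintro rfl
    have h0 : X = 0 := by
      have : X = -X := by simpa using hXZ.symm
      ext i j
      exact self_eq_neg.1 (congrFun (congrFun this i) j)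
    rw [h0] at hXs
    simp at hXs
  -- Anticommutation makes `X v` an eigenvector of `Z` for `-1`, so `v, X v` is an orthonormal basis
  -- in which `X` is the flip.
  obtain ⟨v, hv, hZv⟩ := exists_unit_fixed_vector hZs hne
  have hZX : Z * X = -(X * Z) := by rw [hXZ, neg_neg]
  have hZw : Z *ᵥ (X *ᵥ v) = -(X *ᵥ v) := by
    rw [mulVec_mulVec, hZX, neg_mulVec, ← mulVec_mulVec, hZv]
  have hw : star (X *ᵥ v) ⬝ᵥ (X *ᵥ v) = 1 := by
    rw [star_mulVec, dotProduct_mulVec, vecMul_vecMul, ← star_eq_conjTranspose,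
      mem_unitaryGroup_iff'.1 hX, vecMul_one, hv]
  have hS := twoColumns_mem_unitaryGroup hv hw
    (dotProduct_eq_zero_of_eigen (star_eq_self_of_mul_self_eq_one hZ hZs) hZv hZw)
  refine ⟨_, hS, eq_conj_of_mul_eq hS ?_, eq_conj_of_mul_eq hS ?_⟩
  · rw [mul_twoColumns, twoColumns_mul_pauli_one, mulVec_mulVec, hXs, one_mulVec]
  · rw [mul_twoColumns, twoColumns_mul_pauli_three, hZv, hZw]

theorem conj_conj {n : Type*} [Fintype n] [DecidableEq n] {S A B : Matrix n n ℂ}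
    (hS : S ∈ unitaryGroup n ℂ) (h : A = S * B * star S) : B = star S * A * S := by
  have h1 := mem_unitaryGroup_iff'.1 hS
  rw [h]
  calc B = (star S * S) * B * (star S * S) := by rw [h1]; simp
    _ = _ := by simp only [mul_assoc]

theorem conj_mul_conj {n : Type*} [Fintype n] [DecidableEq n] {S : Matrix n n ℂ}
    (hS : S ∈ unitaryGroup n ℂ) (A B : Matrix n n ℂ) :
    S * A * star S * (S * B * star S) = S * (A * B) * star S := by
  calc S * A * star S * (S * B * star S) = S * A * (star S * S) * (B * star S) := by
        simp only [mul_assoc]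
    _ = _ := by rw [mem_unitaryGroup_iff'.1 hS]; simp only [mul_assoc, one_mul]

/-- Commuting with `σ₃` forces `V` to be diagonal, and `V² = 1` makes its entries signs; whether
they agree decides between `σ₀` and `σ₃`. -/
theorem eq_sign_pauli_of_commute_pauli_three {V : OneQubitOp} (hs : V * V = 1)
    (hc : V * pauli 3 = pauli 3 * V) :
    ∃ s : ℂ, (s = 1 ∨ s = -1) ∧ (V = s • pauli 0 ∨ V = s • pauli 3) := by
  have h01 : V 0 1 = 0 := by
    have := congrFun (congrFun hc 0) 1
    simp only [pauli, mul_apply, Fin.sum_univ_two] at this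
    simp at this
    exact self_eq_neg.1 this.symm
  have h10 : V 1 0 = 0 := by
    have := congrFun (congrFun hc 1) 0
    simp only [pauli, mul_apply, Fin.sum_univ_two] at this
    simp at this
    exact self_eq_neg.1 this
  have h00 : V 0 0 = 1 ∨ V 0 0 = -1 := by
    have := congrFun (congrFun hs 0) 0
    simp only [mul_apply, Fin.sum_univ_two, h01, one_apply_eq] at this
    exact mul_self_eq_one_iff.1 (by simpa using this)
  have h11 : V 1 1 = 1 ∨ V 1 1 = -1 := by
    have := congrFun (congrFun hs 1) 1
    simp only [mul_apply, Fin.sum_univ_two, h10, one_apply_eq] at this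
    exact mul_self_eq_one_iff.1 (by simpa using this)
  refine ⟨V 0 0, h00, ?_⟩
  rcases h00 with h | h <;> rcases h11 with h' | h'
  · left; ext i j; fin_cases i <;> fin_cases j <;> simp [pauli, h, h', h01, h10]
  · right; ext i j; fin_cases i <;> fin_cases j <;> simp [pauli, h, h', h01, h10]
  · right; ext i j; fin_cases i <;> fin_cases j <;> simp [pauli, h, h', h01, h10]
  · left; ext i j; fin_cases i <;> fin_cases j <;> simp [pauli, h, h', h01, h10]

theorem pauli_zero : pauli 0 = 1 := by
  ext i j; fin_cases i <;> fin_cases j <;> simp [pauli]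

theorem sign_pauli_of_eq_one_or_neg_one {V : OneQubitOp} (h : V = 1 ∨ V = -1) :
    ∃ s : ℂ, (s = 1 ∨ s = -1) ∧ (V = s • pauli 0 ∨ V = s • pauli 3) := by
  rcases h with rfl | rfl
  · exact ⟨1, .inl rfl, .inl (by rw [pauli_zero, one_smul])⟩
  · exact ⟨-1, .inr rfl, .inl (by rw [pauli_zero, neg_smul, one_smul])⟩

/-- Two commuting unitary involutions on one qubit are, up to a common conjugation,
`±1` or `±σ₃`. -/
theorem exists_conj_sign_pauli {V W : OneQubitOp} (hV : V ∈ unitaryGroup (Fin 2) ℂ)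
    (hW : W ∈ unitaryGroup (Fin 2) ℂ) (hVs : V * V = 1) (hWs : W * W = 1)
    (hVW : V * W = W * V) :
    ∃ S ∈ unitaryGroup (Fin 2) ℂ,
      (∃ s : ℂ, (s = 1 ∨ s = -1) ∧
        (star S * V * S = s • pauli 0 ∨ star S * V * S = s • pauli 3)) ∧
      (∃ s : ℂ, (s = 1 ∨ s = -1) ∧
        (star S * W * S = s • pauli 0 ∨ star S * W * S = s • pauli 3)) := by
  -- A basis diagonalising a nonscalar `A` diagonalises everything commuting with it; the claim is
  -- applied to whichever of `V`, `W` is nonscalar.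
  have key : ∀ {A B : OneQubitOp}, A ∈ unitaryGroup (Fin 2) ℂ → A * A = 1 → B * B = 1 →
      A * B = B * A → ¬ (A = 1 ∨ A = -1) → ∃ S ∈ unitaryGroup (Fin 2) ℂ,
      (∃ s : ℂ, (s = 1 ∨ s = -1) ∧
        (star S * A * S = s • pauli 0 ∨ star S * A * S = s • pauli 3)) ∧
      (∃ s : ℂ, (s = 1 ∨ s = -1) ∧
        (star S * B * S = s • pauli 0 ∨ star S * B * S = s • pauli 3)) := by
    intro A B hA hAs hBs hAB hne
    push Not at hne
    obtain ⟨S, hS, h⟩ := exists_conj_pauli_three hA hAs hne.1 hne.2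
    have h3 := conj_conj hS h
    have hS' : star S ∈ unitaryGroup (Fin 2) ℂ := Unitary.star_mem hS
    have hm := conj_mul_conj hS'
    rw [star_star] at hm
    refine ⟨S, hS, ⟨1, .inl rfl, .inr (by rw [← h3, one_smul])⟩,
      eq_sign_pauli_of_commute_pauli_three ?_ ?_⟩
    · rw [hm, hBs, mul_one, mem_unitaryGroup_iff'.1 hS]
    · rw [h3, hm, hm, hAB]
  by_cases h1 : V = 1 ∨ V = -1
  · by_cases h2 : W = 1 ∨ W = -1
    · refine ⟨1, one_mem _, ?_, ?_⟩
      · simpa using sign_pauli_of_eq_one_or_neg_one h1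
      · simpa using sign_pauli_of_eq_one_or_neg_one h2
    · obtain ⟨S, hS, ha, hb⟩ := key hW hWs hVs hVW.symm h2
      exact ⟨S, hS, hb, ha⟩
  · exact key hV hVs hWs hVW h1

end Involutions

/-! ### The two-qubit Pauli group and its generators -/

section PauliGroup

open Matrix

theorem phase_mul_mem {c d : ℂ} (hc : c ∈ ({1, -1, Complex.I, -Complex.I} : Set ℂ))
    (hd : d ∈ ({1, -1, Complex.I, -Complex.I} : Set ℂ)) :
    c * d ∈ ({1, -1, Complex.I, -Complex.I} : Set ℂ) := by
  simp only [Set.mem_insert_iff, Set.mem_singleton_iff] at *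
  rcases hc with rfl | rfl | rfl | rfl <;> rcases hd with rfl | rfl | rfl | rfl <;> simp

theorem exists_pauli_mul_eq (j k : Fin 4) :
    ∃ c ∈ ({1, -1, Complex.I, -Complex.I} : Set ℂ), ∃ l, pauli j * pauli k = c • pauli l := by
  -- The Pauli multiplication table: phases first, then indices.
  refine ⟨(![![1, 1, 1, 1], ![1, 1, Complex.I, -Complex.I], ![1, -Complex.I, 1, Complex.I],
    ![1, Complex.I, -Complex.I, 1]] : Fin 4 → Fin 4 → ℂ) j k, ?_,
    (![![0, 1, 2, 3], ![1, 0, 3, 2], ![2, 3, 0, 1], ![3, 2, 1, 0]] : Fin 4 → Fin 4 → Fin 4) j k,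
    ?_⟩
  · fin_cases j <;> fin_cases k <;> simp
  · fin_cases j <;> fin_cases k <;> ext a b <;> fin_cases a <;> fin_cases b <;> simp [pauli]

theorem pauli_mul_self (j : Fin 4) : pauli j * pauli j = 1 := by
  ext a b
  fin_cases j <;> fin_cases a <;> fin_cases b <;> simp [pauli]

theorem star_pauli (j : Fin 4) : star (pauli j) = pauli j := by
  ext a b
  fin_cases j <;> fin_cases a <;> fin_cases b <;> simp [pauli, star_apply]

theorem pauli_mem_unitaryGroup (j : Fin 4) : pauli j ∈ unitaryGroup (Fin 2) ℂ := by
  rw [mem_unitaryGroup_iff, star_pauli, pauli_mul_self]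

theorem pauli_two_eq : pauli 2 = Complex.I • (pauli 1 * pauli 3) := by
  ext a b
  fin_cases a <;> fin_cases b <;> simp [pauli]

theorem pauli_one_mul_pauli_three : pauli 1 * pauli 3 = -(pauli 3 * pauli 1) := by
  ext a b
  fin_cases a <;> fin_cases b <;> simp [pauli]

theorem smul_kronecker_mem_pauliGroupTwo {c : ℂ}
    (hc : c ∈ ({1, -1, Complex.I, -Complex.I} : Set ℂ)) (j k : Fin 4) :
    c • (pauli j ⊗ₖ pauli k) ∈ pauliGroupTwo :=
  ⟨c, hc, j, k, rfl⟩

theorem kronecker_mem_pauliGroupTwo (j k : Fin 4) : pauli j ⊗ₖ pauli k ∈ pauliGroupTwo :=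
  ⟨1, by simp, j, k, by rw [one_smul]⟩

theorem mul_mem_pauliGroupTwo {g h : TwoQubitOp} (hg : g ∈ pauliGroupTwo)
    (hh : h ∈ pauliGroupTwo) : g * h ∈ pauliGroupTwo := by
  obtain ⟨c, hc, j, k, rfl⟩ := hg
  obtain ⟨d, hd, j', k', rfl⟩ := hh
  obtain ⟨e, he, l, hl⟩ := exists_pauli_mul_eq j j'
  obtain ⟨f, hf, m, hm⟩ := exists_pauli_mul_eq k k'
  refine ⟨c * d * (e * f), phase_mul_mem (phase_mul_mem hc hd) (phase_mul_mem he hf), l, m, ?_⟩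
  rw [smul_mul_smul_comm, ← mul_kronecker_mul, hl, hm, smul_kronecker, kronecker_smul,
    smul_smul, smul_smul, mul_assoc (c * d)]

theorem smul_mem_pauliGroupTwo {c : ℂ} (hc : c ∈ ({1, -1, Complex.I, -Complex.I} : Set ℂ))
    {g : TwoQubitOp} (hg : g ∈ pauliGroupTwo) : c • g ∈ pauliGroupTwo := by
  obtain ⟨d, hd, j, k, rfl⟩ := hg
  exact ⟨c * d, phase_mul_mem hc hd, j, k, by rw [smul_smul]⟩

theorem star_kronecker (A B : OneQubitOp) : star (A ⊗ₖ B) = star A ⊗ₖ star B :=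
  conjTranspose_kronecker A B

theorem kronecker_mem_unitaryGroup {A B : OneQubitOp} (hA : A ∈ unitaryGroup (Fin 2) ℂ)
    (hB : B ∈ unitaryGroup (Fin 2) ℂ) : A ⊗ₖ B ∈ unitaryGroup (Fin 2 × Fin 2) ℂ := by
  rw [mem_unitaryGroup_iff, star_kronecker, ← mul_kronecker_mul, mem_unitaryGroup_iff.1 hA,
    mem_unitaryGroup_iff.1 hB, one_kronecker_one]

/-- A unitary is Clifford as soon as it maps a generating set of Pauli operators into the
Pauli group. -/
theorem mem_cliffordGroupTwo_of_generators {U : TwoQubitOp}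
    (hU : U ∈ unitaryGroup (Fin 2 × Fin 2) ℂ)
    (hx : U * (pauli 1 ⊗ₖ (1 : OneQubitOp)) * star U ∈ pauliGroupTwo)
    (hz : U * (pauli 3 ⊗ₖ (1 : OneQubitOp)) * star U ∈ pauliGroupTwo)
    (hx' : U * ((1 : OneQubitOp) ⊗ₖ pauli 1) * star U ∈ pauliGroupTwo)
    (hz' : U * ((1 : OneQubitOp) ⊗ₖ pauli 3) * star U ∈ pauliGroupTwo) :
    U ∈ cliffordGroupTwo := by
  have h1 : U * (1 : TwoQubitOp) * star U ∈ pauliGroupTwo := by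
    have := kronecker_mem_pauliGroupTwo 0 0
    rwa [mul_one, mem_unitaryGroup_iff.1 hU, ← one_kronecker_one, ← pauli_zero]
  have hI : Complex.I ∈ ({1, -1, Complex.I, -Complex.I} : Set ℂ) := by simp
  have hl : ∀ j, U * (pauli j ⊗ₖ (1 : OneQubitOp)) * star U ∈ pauliGroupTwo := by
    intro j
    fin_cases j
    · simpa [pauli_zero] using h1
    · exact hx
    · have := smul_mem_pauliGroupTwo hI (mul_mem_pauliGroupTwo hx hz)
      rw [conj_mul_conj hU, ← mul_kronecker_mul, mul_one, ← smul_mul_assoc, ← mul_smul_comm,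
        ← smul_kronecker, ← pauli_two_eq] at this
      exact this
    · exact hz
  have hr : ∀ j, U * ((1 : OneQubitOp) ⊗ₖ pauli j) * star U ∈ pauliGroupTwo := by
    intro j
    fin_cases j
    · simpa [pauli_zero] using h1
    · exact hx'
    · have := smul_mem_pauliGroupTwo hI (mul_mem_pauliGroupTwo hx' hz')
      rw [conj_mul_conj hU, ← mul_kronecker_mul, mul_one, ← smul_mul_assoc, ← mul_smul_comm,
        ← kronecker_smul, ← pauli_two_eq] at this
      exact this
    · exact hz'
  refine ⟨hU, ?_⟩
  rintro _ ⟨c, hc, j, k, rfl⟩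
  have := smul_mem_pauliGroupTwo hc (mul_mem_pauliGroupTwo (hl j) (hr k))
  rwa [conj_mul_conj hU, ← mul_kronecker_mul, mul_one, one_mul, ← smul_mul_assoc,
    ← mul_smul_comm] at this

end PauliGroup

/-! ### Factors of product operators -/

section TensorFactors

open Matrix

/-- The tensor factors of a nonzero scalar operator are scalar. -/
theorem eq_smul_one_of_kronecker_eq_smul_one {A B : OneQubitOp} {a : ℂ} (ha : a ≠ 0)
    (h : A ⊗ₖ B = a • (1 : TwoQubitOp)) :
    ∃ c d : ℂ, c * d = a ∧ A = c • (1 : OneQubitOp) ∧ B = d • (1 : OneQubitOp) := by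
  have he : ∀ i k j l, A i j * B k l = a * ((1 : OneQubitOp) i j * (1 : OneQubitOp) k l) := by
    intro i k j l
    have := congrFun (congrFun h (i, k)) (j, l)
    rw [← one_kronecker_one] at this
    exact this
  have h00 : A 0 0 * B 0 0 = a := by simpa using he 0 0 0 0
  have hA0 : A 0 0 ≠ 0 := by rintro h; simp [h] at h00; exact ha h00.symm
  have hB0 : B 0 0 ≠ 0 := by rintro h; simp [h] at h00; exact ha h00.symm
  refine ⟨A 0 0, B 0 0, h00, ?_, ?_⟩
  · ext i j
    apply mul_right_cancel₀ hB0
    rw [he, Matrix.smul_apply, smul_eq_mul, one_apply_eq, mul_one, ← h00]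
    ring
  · ext k l
    apply mul_left_cancel₀ hA0
    rw [he, Matrix.smul_apply, smul_eq_mul, one_apply_eq, one_mul, ← h00]
    ring

theorem star_mul_self_eq_one_of_smul_one_mem {c : ℂ}
    (h : c • (1 : OneQubitOp) ∈ unitaryGroup (Fin 2) ℂ) : star c * c = 1 := by
  have := congrFun (congrFun (mem_unitaryGroup_iff'.1 h) 0) 0
  simpa [star_smul, smul_mul_smul_comm, mul_comm] using this

theorem smul_mem_unitaryGroup {n : Type*} [Fintype n] [DecidableEq n] {c : ℂ}
    (hc : star c * c = 1) {A : Matrix n n ℂ} (hA : A ∈ unitaryGroup n ℂ) :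
    c • A ∈ unitaryGroup n ℂ := by
  rw [mem_unitaryGroup_iff', star_smul, smul_mul_smul_comm, mem_unitaryGroup_iff'.1 hA, hc,
    one_smul]

/-- The factors of a product unitary that squares to one can be rescaled to involutions. -/
theorem exists_involutive_factors {T V : OneQubitOp} (hT : T ∈ unitaryGroup (Fin 2) ℂ)
    (hV : V ∈ unitaryGroup (Fin 2) ℂ) (h : (T ⊗ₖ V) * (T ⊗ₖ V) = 1) :
    ∃ T' ∈ unitaryGroup (Fin 2) ℂ, ∃ V' ∈ unitaryGroup (Fin 2) ℂ,
      T' * T' = 1 ∧ V' * V' = 1 ∧ T' ⊗ₖ V' = T ⊗ₖ V := by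
  rw [← mul_kronecker_mul] at h
  obtain ⟨c, d, hcd, hc, hd⟩ :=
    eq_smul_one_of_kronecker_eq_smul_one one_ne_zero (h.trans (one_smul ℂ _).symm)
  have hcu : star c * c = 1 :=
    star_mul_self_eq_one_of_smul_one_mem (hc ▸ mul_mem hT hT)
  obtain ⟨r, hr⟩ := IsSquare.exists_sq c (IsAlgClosed.exists_eq_mul_self c)
  have hrn : ‖r‖ = 1 := by
    have h1 : ‖c‖ * ‖c‖ = 1 := by
      have := congrArg norm hcu
      simpa using this
    have h2 : ‖c‖ = 1 := by nlinarith [norm_nonneg c]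
    rw [hr, norm_pow] at h2
    nlinarith [norm_nonneg r]
  have hru : star r * r = 1 := by
    rw [Complex.star_def, ← Complex.normSq_eq_conj_mul_self, Complex.normSq_eq_norm_sq, hrn]
    simp
  have hr' : star (star r) * star r = 1 := by rw [star_star, mul_comm, hru]
  -- Here `T² = c` and `V² = d` with `cd = 1` and `r² = c`; as `|r| = 1`, `star r` is `r⁻¹`.
  refine ⟨star r • T, smul_mem_unitaryGroup hr' hT, r • V, smul_mem_unitaryGroup hru hV,
    ?_, ?_, ?_⟩
  · rw [smul_mul_smul_comm, hc, hr, smul_smul]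
    rw [show star r * star r * r ^ 2 = (star r * r) * (star r * r) by ring, hru]
    simp
  · rw [smul_mul_smul_comm, hd, smul_smul, ← pow_two, ← hr, hcd, one_smul]
  · rw [smul_kronecker, kronecker_smul, smul_smul, hru, one_smul]

/-- The factors of two anticommuting product involutions commute on one side and anticommute
on the other. -/
theorem commute_or_anticommute_factors {T₁ V₁ T₃ V₃ : OneQubitOp}
    (hT₁ : T₁ * T₁ = 1) (hT₃ : T₃ * T₃ = 1) (hV₁ : V₁ * V₁ = 1) (hV₃ : V₃ * V₃ = 1)
    (h : (T₁ ⊗ₖ V₁) * (T₃ ⊗ₖ V₃) = -((T₃ ⊗ₖ V₃) * (T₁ ⊗ₖ V₁))) :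
    (T₁ * T₃ = -(T₃ * T₁) ∧ V₁ * V₃ = V₃ * V₁) ∨
      (V₁ * V₃ = -(V₃ * V₁) ∧ T₁ * T₃ = T₃ * T₁) := by
  -- The product of two anticommuting involutions squares to `-1`, so both factors square to scalars
  -- `c`, `d` with `cd = -1`.
  have hsq : ((T₁ * T₃) * (T₁ * T₃)) ⊗ₖ ((V₁ * V₃) * (V₁ * V₃)) = (-1 : ℂ) • (1 : TwoQubitOp) := by
    rw [mul_kronecker_mul, mul_kronecker_mul]
    nth_rewrite 1 [h]
    rw [neg_mul, ← mul_kronecker_mul, ← mul_kronecker_mul, ← mul_kronecker_mul]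
    rw [show T₃ * T₁ * (T₁ * T₃) = T₃ * (T₁ * T₁) * T₃ by simp only [mul_assoc],
      show V₃ * V₁ * (V₁ * V₃) = V₃ * (V₁ * V₁) * V₃ by simp only [mul_assoc], hT₁, hV₁,
      mul_one, mul_one, hT₃, hV₃, one_kronecker_one, neg_smul, one_smul]
  obtain ⟨c, d, hcd, hc, hd⟩ := eq_smul_one_of_kronecker_eq_smul_one (by simp) hsq
  -- For involutions, `(XY)² = e` means `XY = e YX`; conjugating by `X` gives `YX = e XY`, so `e² =
  -- 1`.
  have comm : ∀ {X Y : OneQubitOp} {e : ℂ}, X * X = 1 → Y * Y = 1 →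
      (X * Y) * (X * Y) = e • (1 : OneQubitOp) → X * Y = e • (Y * X) ∧ e * e = 1 := by
    intro X Y e hX hY hXY
    have h1 : X * Y = e • (Y * X) := by
      calc X * Y = (X * Y) * (X * (Y * Y) * X) := by rw [hY, mul_one, hX, mul_one]
        _ = ((X * Y) * (X * Y)) * (Y * X) := by simp only [mul_assoc]
        _ = e • (Y * X) := by rw [hXY, smul_mul_assoc, one_mul]
    refine ⟨h1, ?_⟩
    have h2 : Y * X = e • (X * Y) := by
      calc Y * X = X * (X * Y) * X := by rw [← mul_assoc, hX, one_mul]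
        _ = X * (e • (Y * X)) * X := by rw [← h1]
        _ = e • (X * Y * (X * X)) := by simp only [mul_smul_comm, smul_mul_assoc, mul_assoc]
        _ = e • (X * Y) := by rw [hX, mul_one]
    have h3 : X * Y * (Y * X) = 1 := by
      rw [mul_assoc, ← mul_assoc Y, hY, one_mul, hX]
    have h4 : (e * e) • (1 : OneQubitOp) = 1 := by
      calc (e * e) • (1 : OneQubitOp) = (e • (e • (X * Y))) * (Y * X) := by
            rw [smul_smul, smul_mul_assoc, h3]
        _ = 1 := by rw [← h2, ← h1, h3]
    simpa using congrFun (congrFun h4 0) 0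
  obtain ⟨h1, hcc⟩ := comm hT₁ hT₃ hc
  obtain ⟨h2, -⟩ := comm hV₁ hV₃ hd
  rcases mul_self_eq_one_iff.1 hcc with rfl | rfl
  · right
    have : d = -1 := by simpa using hcd
    subst this
    exact ⟨by simpa using h2, by simpa using h1⟩
  · left
    have : d = 1 := by simpa using hcd
    subst this
    exact ⟨by simpa using h1, by simpa using h2⟩

end TensorFactors

/-! ### Completing the Pauli images to a Clifford operator -/

section CliffordExtension

open Matrix

/-- The commutant of the operators on the first qubit consists of operators on the second. -/
theorem exists_eq_one_kronecker_of_commute {M : TwoQubitOp}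
    (hx : M * (pauli 1 ⊗ₖ (1 : OneQubitOp)) = (pauli 1 ⊗ₖ (1 : OneQubitOp)) * M)
    (hz : M * (pauli 3 ⊗ₖ (1 : OneQubitOp)) = (pauli 3 ⊗ₖ (1 : OneQubitOp)) * M) :
    ∃ W : OneQubitOp, M = (1 : OneQubitOp) ⊗ₖ W := by
  -- Commuting with `σ₃ ⊗ 1` kills the off-diagonal blocks; commuting with `σ₁ ⊗ 1` equates the
  -- diagonal ones.
  have h01 : ∀ k l, M (0, k) (1, l) = 0 := by
    intro k l
    have := congrFun (congrFun hz (0, k)) (1, l)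
    simp [mul_apply, Fintype.sum_prod_type, pauli, one_apply] at this
    exact self_eq_neg.1 this.symm
  have h10 : ∀ k l, M (1, k) (0, l) = 0 := by
    intro k l
    have := congrFun (congrFun hz (1, k)) (0, l)
    simp [mul_apply, Fintype.sum_prod_type, pauli, one_apply] at this
    exact self_eq_neg.1 this
  have h11 : ∀ k l, M (1, k) (1, l) = M (0, k) (0, l) := by
    intro k l
    have := congrFun (congrFun hx (0, k)) (1, l)
    simp [mul_apply, Fintype.sum_prod_type, pauli, one_apply] at this
    exact this.symm
  refine ⟨of fun k l => M (0, k) (0, l), ?_⟩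
  ext ⟨i, k⟩ ⟨j, l⟩
  fin_cases i <;> fin_cases j <;> simp [h01, h10, h11]

theorem one_kronecker_injective {A B : OneQubitOp}
    (h : (1 : OneQubitOp) ⊗ₖ A = (1 : OneQubitOp) ⊗ₖ B) : A = B := by
  ext i j
  simpa using congrFun (congrFun h (0, i)) (0, j)

theorem mem_unitaryGroup_of_one_kronecker {W : OneQubitOp}
    (h : (1 : OneQubitOp) ⊗ₖ W ∈ unitaryGroup (Fin 2 × Fin 2) ℂ) :
    W ∈ unitaryGroup (Fin 2) ℂ := by
  rw [mem_unitaryGroup_iff, star_kronecker, star_one, ← mul_kronecker_mul, mul_one,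
    ← one_kronecker_one] at h
  exact mem_unitaryGroup_iff.2 (one_kronecker_injective h)

theorem neg_kronecker (A B : OneQubitOp) : (-A) ⊗ₖ B = -(A ⊗ₖ B) := by
  ext
  simp

theorem kronecker_neg (A B : OneQubitOp) : A ⊗ₖ (-B) = -(A ⊗ₖ B) := by
  ext
  simp

/-- Some Pauli operator acting as `σ₁` on the second qubit commutes with both given ones. -/
theorem exists_pauli_commuting {a b : Fin 4} (ha : a = 0 ∨ a = 3) (hb : b = 0 ∨ b = 3) :
    ∃ p : Fin 4,
      (pauli p ⊗ₖ pauli 1) * (pauli 1 ⊗ₖ pauli a) = (pauli 1 ⊗ₖ pauli a) * (pauli p ⊗ₖ pauli 1) ∧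
      (pauli p ⊗ₖ pauli 1) * (pauli 3 ⊗ₖ pauli b) =
        (pauli 3 ⊗ₖ pauli b) * (pauli p ⊗ₖ pauli 1) := by
  have hneg : ∀ A B : OneQubitOp, (-A) ⊗ₖ (-B) = A ⊗ₖ B := fun A B => by
    rw [neg_kronecker, kronecker_neg, neg_neg]
  have h12 : pauli 2 * pauli 1 = -(pauli 1 * pauli 2) := by
    ext i j; fin_cases i <;> fin_cases j <;> simp [pauli]
  have h23 : pauli 2 * pauli 3 = -(pauli 3 * pauli 2) := by
    ext i j; fin_cases i <;> fin_cases j <;> simp [pauli]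
  simp only [← mul_kronecker_mul]
  -- The sign from the second qubit must be cancelled on the first: `σ_p` anticommutes with `σ₁`
  -- exactly when `a = 3`, and with `σ₃` exactly when `b = 3`.
  rcases ha with rfl | rfl <;> rcases hb with rfl | rfl
  · exact ⟨0, by simp [pauli_zero], by simp [pauli_zero]⟩
  · exact ⟨1, by simp [pauli_zero],
      by rw [pauli_one_mul_pauli_three, hneg]⟩
  · exact ⟨3, by rw [pauli_one_mul_pauli_three, kronecker_neg, neg_kronecker], by simp [pauli_zero]⟩
  · exact ⟨2, by rw [pauli_one_mul_pauli_three, h12, hneg],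
      by rw [pauli_one_mul_pauli_three, h23, hneg]⟩

theorem commute_conj {n : Type*} [Fintype n] [DecidableEq n] {U A B C : Matrix n n ℂ} {s : ℂ}
    (hU : U ∈ unitaryGroup n ℂ) (h : U * A * star U = s • C) (hB : B * C = C * B) :
    (star U * B * U) * A = A * (star U * B * U) := by
  have hA : A = star U * (s • C) * U := conj_conj hU h.symm
  have hm := conj_mul_conj (Unitary.star_mem hU)
  rw [star_star] at hm
  rw [hA, hm, hm, mul_smul_comm, hB, smul_mul_assoc]

/-- A unitary mapping the Pauli operators on the first qubit to suitable Pauli operators becomes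
Clifford after a rotation of the second qubit. -/
theorem exists_mul_one_kronecker_mem_cliffordGroupTwo {U : TwoQubitOp}
    (hU : U ∈ unitaryGroup (Fin 2 × Fin 2) ℂ) {s t : ℂ} {a b : Fin 4}
    (hs : s = 1 ∨ s = -1) (ht : t = 1 ∨ t = -1) (ha : a = 0 ∨ a = 3) (hb : b = 0 ∨ b = 3)
    (hx : U * (pauli 1 ⊗ₖ (1 : OneQubitOp)) * star U = s • (pauli 1 ⊗ₖ pauli a))
    (hz : U * (pauli 3 ⊗ₖ (1 : OneQubitOp)) * star U = t • (pauli 3 ⊗ₖ pauli b)) :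
    ∃ S ∈ unitaryGroup (Fin 2) ℂ, U * ((1 : OneQubitOp) ⊗ₖ S) ∈ cliffordGroupTwo := by
  obtain ⟨p, hp1, hp3⟩ := exists_pauli_commuting ha hb
  have hcomm : pauli 3 * pauli a = pauli a * pauli 3 ∧ pauli 3 * pauli b = pauli b * pauli 3 := by
    constructor
    · rcases ha with rfl | rfl <;> simp [pauli_zero]
    · rcases hb with rfl | rfl <;> simp [pauli_zero]
  -- `X` and `Z` are the intended images of `1 ⊗ σ₁` and `1 ⊗ σ₃`.
  set X := pauli p ⊗ₖ pauli 1 with hX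
  set Z := pauli 0 ⊗ₖ pauli 3 with hZ
  have hXm : X ∈ unitaryGroup (Fin 2 × Fin 2) ℂ :=
    kronecker_mem_unitaryGroup (pauli_mem_unitaryGroup _) (pauli_mem_unitaryGroup _)
  have hZm : Z ∈ unitaryGroup (Fin 2 × Fin 2) ℂ :=
    kronecker_mem_unitaryGroup (pauli_mem_unitaryGroup _) (pauli_mem_unitaryGroup _)
  have hXX : X * X = 1 := by
    rw [hX, ← mul_kronecker_mul, pauli_mul_self, pauli_mul_self, one_kronecker_one]
  have hZZ : Z * Z = 1 := by
    rw [hZ, ← mul_kronecker_mul, pauli_mul_self, pauli_mul_self, one_kronecker_one]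
  have hXZ : X * Z = -(Z * X) := by
    rw [hX, hZ, ← mul_kronecker_mul, ← mul_kronecker_mul, pauli_one_mul_pauli_three, pauli_zero,
      mul_one, one_mul, kronecker_neg]
  have hZ1 : Z * (pauli 1 ⊗ₖ pauli a) = (pauli 1 ⊗ₖ pauli a) * Z := by
    rw [hZ, ← mul_kronecker_mul, ← mul_kronecker_mul, hcomm.1, pauli_zero, mul_one, one_mul]
  have hZ3 : Z * (pauli 3 ⊗ₖ pauli b) = (pauli 3 ⊗ₖ pauli b) * Z := by
    rw [hZ, ← mul_kronecker_mul, ← mul_kronecker_mul, hcomm.2, pauli_zero, mul_one, one_mul]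
  obtain ⟨A, hA⟩ := exists_eq_one_kronecker_of_commute
    (commute_conj hU hx hp1) (commute_conj hU hz hp3)
  obtain ⟨B, hB⟩ := exists_eq_one_kronecker_of_commute
    (commute_conj hU hx hZ1) (commute_conj hU hz hZ3)
  have hU' := Unitary.star_mem hU
  have hm := conj_mul_conj hU'
  rw [star_star] at hm
  have hAm : A ∈ unitaryGroup (Fin 2) ℂ :=
    mem_unitaryGroup_of_one_kronecker (hA ▸ mul_mem (mul_mem hU' hXm) hU)
  have hBm : B ∈ unitaryGroup (Fin 2) ℂ :=
    mem_unitaryGroup_of_one_kronecker (hB ▸ mul_mem (mul_mem hU' hZm) hU)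
  have hAA : A * A = 1 := by
    apply one_kronecker_injective
    nth_rewrite 1 [← mul_one (1 : OneQubitOp)]
    rw [mul_kronecker_mul, ← hA, hm, hXX, mul_one, mem_unitaryGroup_iff'.1 hU, one_kronecker_one]
  have hBB : B * B = 1 := by
    apply one_kronecker_injective
    nth_rewrite 1 [← mul_one (1 : OneQubitOp)]
    rw [mul_kronecker_mul, ← hB, hm, hZZ, mul_one, mem_unitaryGroup_iff'.1 hU, one_kronecker_one]
  have hAB : A * B = -(B * A) := by
    apply one_kronecker_injective
    have hk : ∀ C D : OneQubitOp, (1 : OneQubitOp) ⊗ₖ (C * D) =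
        ((1 : OneQubitOp) ⊗ₖ C) * ((1 : OneQubitOp) ⊗ₖ D) := fun C D => by
      rw [← mul_kronecker_mul, one_mul]
    rw [kronecker_neg, hk, hk, ← hA, ← hB, hm, hm, hXZ, mul_neg, neg_mul]
  obtain ⟨S, hS, hAS, hBS⟩ := exists_conj_pauli_pair hAm hBm hAA hBB hAB
  have hSm := kronecker_mem_unitaryGroup (one_mem (unitaryGroup (Fin 2) ℂ)) hS
  have hconj : ∀ C D : OneQubitOp, U * ((1 : OneQubitOp) ⊗ₖ S) * (C ⊗ₖ D) *
      star (U * ((1 : OneQubitOp) ⊗ₖ S)) = U * (C ⊗ₖ (S * D * star S)) * star U := by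
    intro C D
    have : C ⊗ₖ (S * D * star S) = ((1 : OneQubitOp) ⊗ₖ S) * (C ⊗ₖ D) *
        star ((1 : OneQubitOp) ⊗ₖ S) := by
      rw [star_kronecker, star_one, ← mul_kronecker_mul, ← mul_kronecker_mul, one_mul, mul_one]
    rw [this, star_mul]
    simp only [mul_assoc]
  have hsign : ∀ {r : ℂ}, r = 1 ∨ r = -1 → r ∈ ({1, -1, Complex.I, -Complex.I} : Set ℂ) := by
    rintro r (rfl | rfl) <;> simp
  refine ⟨S, hS, mem_cliffordGroupTwo_of_generators (mul_mem hU hSm) ?_ ?_ ?_ ?_⟩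
  · rw [hconj, mul_one, mem_unitaryGroup_iff.1 hS, hx]
    exact smul_kronecker_mem_pauliGroupTwo (hsign hs) _ _
  · rw [hconj, mul_one, mem_unitaryGroup_iff.1 hS, hz]
    exact smul_kronecker_mem_pauliGroupTwo (hsign ht) _ _
  · have h := conj_conj hU' (A := (1 : OneQubitOp) ⊗ₖ A) (B := X)
      (by rw [star_star]; exact hA.symm)
    rw [star_star] at h
    rw [hconj, ← hAS, ← h, hX]
    exact kronecker_mem_pauliGroupTwo _ _
  · have h := conj_conj hU' (A := (1 : OneQubitOp) ⊗ₖ B) (B := Z)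
      (by rw [star_star]; exact hB.symm)
    rw [star_star] at h
    rw [hconj, ← hBS, ← h, hZ]
    exact kronecker_mem_pauliGroupTwo _ _

/-- If the images of `σ₁ ⊗ 1` and `σ₃ ⊗ 1` anticommute on the first tensor factor, then the
unitary is locally equivalent to a Clifford operator. -/
theorem exists_local_mem_cliffordGroupTwo {U : TwoQubitOp}
    (hU : U ∈ unitaryGroup (Fin 2 × Fin 2) ℂ) {T₁ V₁ T₃ V₃ : OneQubitOp}
    (hT₁ : T₁ ∈ unitaryGroup (Fin 2) ℂ) (hT₃ : T₃ ∈ unitaryGroup (Fin 2) ℂ)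
    (hV₁ : V₁ ∈ unitaryGroup (Fin 2) ℂ) (hV₃ : V₃ ∈ unitaryGroup (Fin 2) ℂ)
    (hT₁s : T₁ * T₁ = 1) (hT₃s : T₃ * T₃ = 1) (hV₁s : V₁ * V₁ = 1) (hV₃s : V₃ * V₃ = 1)
    (hT : T₁ * T₃ = -(T₃ * T₁)) (hV : V₁ * V₃ = V₃ * V₁)
    (hx : U * (pauli 1 ⊗ₖ (1 : OneQubitOp)) * star U = T₁ ⊗ₖ V₁)
    (hz : U * (pauli 3 ⊗ₖ (1 : OneQubitOp)) * star U = T₃ ⊗ₖ V₃) :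
    ∃ R ∈ unitaryGroup (Fin 2) ℂ, ∃ S ∈ unitaryGroup (Fin 2) ℂ,
      ∃ S' ∈ unitaryGroup (Fin 2) ℂ,
        (R ⊗ₖ S) * U * ((1 : OneQubitOp) ⊗ₖ S') ∈ cliffordGroupTwo := by
  obtain ⟨R, hR, hRx, hRz⟩ := exists_conj_pauli_pair hT₁ hT₃ hT₁s hT₃s hT
  obtain ⟨S, hS, ⟨s, hs, hs'⟩, ⟨t, ht, ht'⟩⟩ := exists_conj_sign_pauli hV₁ hV₃ hV₁s hV₃s hV
  obtain ⟨a, ha, haS⟩ : ∃ a : Fin 4, (a = 0 ∨ a = 3) ∧ star S * V₁ * S = s • pauli a := by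
    rcases hs' with h | h
    exacts [⟨0, .inl rfl, h⟩, ⟨3, .inr rfl, h⟩]
  obtain ⟨b, hb, hbS⟩ : ∃ b : Fin 4, (b = 0 ∨ b = 3) ∧ star S * V₃ * S = t • pauli b := by
    rcases ht' with h | h
    exacts [⟨0, .inl rfl, h⟩, ⟨3, .inr rfl, h⟩]
  have hR' := Unitary.star_mem hR
  have hS' := Unitary.star_mem hS
  have hconj : ∀ {M : TwoQubitOp} {T V : OneQubitOp}, U * M * star U = T ⊗ₖ V →
      ((star R ⊗ₖ star S) * U) * M * star ((star R ⊗ₖ star S) * U) =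
        (star R * T * R) ⊗ₖ (star S * V * S) := by
    intro M T V h
    rw [mul_kronecker_mul, mul_kronecker_mul, ← h, star_mul, star_kronecker, star_star, star_star]
    simp only [mul_assoc]
  obtain ⟨S₂, hS₂, h⟩ := exists_mul_one_kronecker_mem_cliffordGroupTwo
    (mul_mem (kronecker_mem_unitaryGroup hR' hS') hU) hs ht ha hb
    (by rw [hconj hx, haS, ← conj_conj hR hRx, kronecker_smul])
    (by rw [hconj hz, hbS, ← conj_conj hR hRz, kronecker_smul])
  exact ⟨_, hR', _, hS', S₂, hS₂, h⟩

end CliffordExtension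

/-! ### Exchange of the qubits -/

section Swap

open Matrix

/-- The operator exchanging the two qubits. -/
def swapOp : TwoQubitOp := Matrix.of fun a b => if a.swap = b then 1 else 0

theorem swapOp_mul_apply (M : TwoQubitOp) (a b : Fin 2 × Fin 2) :
    (swapOp * M) a b = M a.swap b := by
  simp [swapOp, mul_apply]

theorem star_swapOp : star swapOp = swapOp := by
  ext ⟨a, b⟩ ⟨c, d⟩
  simp [swapOp, star_apply, and_comm, eq_comm, apply_ite]

theorem swapOp_mul_self : swapOp * swapOp = 1 := by
  ext a b
  rw [swapOp_mul_apply]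
  simp [swapOp, one_apply]

theorem swapOp_mem_unitaryGroup : swapOp ∈ unitaryGroup (Fin 2 × Fin 2) ℂ := by
  rw [mem_unitaryGroup_iff, star_swapOp, swapOp_mul_self]

theorem swapOp_mul_kronecker (A B : OneQubitOp) :
    swapOp * (A ⊗ₖ B) = (B ⊗ₖ A) * swapOp := by
  ext ⟨a, b⟩ ⟨c, d⟩
  rw [swapOp_mul_apply]
  simp [swapOp, mul_apply, Fintype.sum_prod_type, ite_and, mul_comm]

theorem swapOp_conj_kronecker (A B : OneQubitOp) :
    swapOp * (A ⊗ₖ B) * star swapOp = B ⊗ₖ A := by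
  rw [swapOp_mul_kronecker, star_swapOp, mul_assoc, swapOp_mul_self, mul_one]

theorem swapOp_mul_mem_cliffordGroupTwo {C : TwoQubitOp} (hC : C ∈ cliffordGroupTwo) :
    swapOp * C ∈ cliffordGroupTwo := by
  refine ⟨mul_mem swapOp_mem_unitaryGroup hC.1, fun g hg => ?_⟩
  obtain ⟨c, hc, j, k, h⟩ := hC.2 g hg
  refine ⟨c, hc, k, j, ?_⟩
  calc swapOp * C * g * star (swapOp * C) = swapOp * (C * g * star C) * star swapOp := by
        rw [star_mul]; simp only [mul_assoc]
    _ = _ := by rw [h, mul_smul_comm, smul_mul_assoc, swapOp_conj_kronecker]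

end Swap

/-! ### The two implications -/

open Matrix in
theorem exists_mem_cliffordGroupTwo_of_mem_familyL {U : TwoQubitOp} (h : U ∈ familyL) :
    ∃ C ∈ cliffordGroupTwo, LocallyEquivalent U C := by
  obtain ⟨hU, R, hR, h⟩ := h
  obtain ⟨T₁, hT₁, V₁, hV₁, h₁⟩ := h 1 (by decide)
  obtain ⟨T₃, hT₃, V₃, hV₃, h₃⟩ := h 3 (by decide)
  have hR1 := kronecker_mem_unitaryGroup hR (one_mem (unitaryGroup (Fin 2) ℂ))
  -- Passing to `Q` reduces to the case where the rotated Paulis are the standard ones.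
  set Q := U * (R ⊗ₖ (1 : OneQubitOp)) with hQ
  have hQm : Q ∈ unitaryGroup (Fin 2 × Fin 2) ℂ := mul_mem hU hR1
  have hconj : ∀ P : OneQubitOp, Q * (P ⊗ₖ (1 : OneQubitOp)) * star Q =
      U * ((R * P * star R) ⊗ₖ (1 : OneQubitOp)) * star U := by
    intro P
    have : (R * P * star R) ⊗ₖ (1 : OneQubitOp) = (R ⊗ₖ (1 : OneQubitOp)) *
        (P ⊗ₖ (1 : OneQubitOp)) * star (R ⊗ₖ (1 : OneQubitOp)) := by
      rw [star_kronecker, star_one, ← mul_kronecker_mul, ← mul_kronecker_mul, one_mul, mul_one]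
    rw [this, hQ, star_mul]
    simp only [mul_assoc]
  rw [← hconj] at h₁ h₃
  have hsq : ∀ {j : Fin 4} {T V : OneQubitOp},
      Q * (pauli j ⊗ₖ (1 : OneQubitOp)) * star Q = T ⊗ₖ V → (T ⊗ₖ V) * (T ⊗ₖ V) = 1 := by
    intro j T V h
    rw [← h, conj_mul_conj hQm, ← mul_kronecker_mul, pauli_mul_self, mul_one, one_kronecker_one,
      mul_one, mem_unitaryGroup_iff.1 hQm]
  obtain ⟨X, hX, Y, hY, hXX, hYY, hXY⟩ := exists_involutive_factors hT₁ hV₁ (hsq h₁)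
  obtain ⟨X', hX', Y', hY', hXX', hYY', hXY'⟩ := exists_involutive_factors hT₃ hV₃ (hsq h₃)
  rw [← hXY] at h₁
  rw [← hXY'] at h₃
  have hanti : (X ⊗ₖ Y) * (X' ⊗ₖ Y') = -((X' ⊗ₖ Y') * (X ⊗ₖ Y)) := by
    rw [← h₁, ← h₃, conj_mul_conj hQm, conj_mul_conj hQm, ← mul_kronecker_mul,
      ← mul_kronecker_mul, pauli_one_mul_pauli_three, neg_kronecker, mul_neg, neg_mul]
  have hright : ∀ S : OneQubitOp, Q * ((1 : OneQubitOp) ⊗ₖ S) = U * (R ⊗ₖ S) := by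
    intro S
    rw [hQ, mul_assoc, ← mul_kronecker_mul, one_mul, mul_one]
  rcases commute_or_anticommute_factors hXX hXX' hYY hYY' hanti with ⟨ha, hc⟩ | ⟨ha, hc⟩
  · obtain ⟨A, hA, B, hB, S, hS, hmem⟩ := exists_local_mem_cliffordGroupTwo hQm hX hX' hY hY'
      hXX hXX' hYY hYY' ha hc h₁ h₃
    refine ⟨_, hmem, A, hA, B, hB, R, hR, S, hS, ?_⟩
    rw [mul_assoc, hright, mul_assoc]
  · have hswap : ∀ {M : TwoQubitOp} {T V : OneQubitOp}, Q * M * star Q = T ⊗ₖ V →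
        (swapOp * Q) * M * star (swapOp * Q) = V ⊗ₖ T := by
      intro M T V h
      rw [← swapOp_conj_kronecker, ← h, star_mul]
      simp only [mul_assoc]
    obtain ⟨A, hA, B, hB, S, hS, hmem⟩ := exists_local_mem_cliffordGroupTwo
      (mul_mem swapOp_mem_unitaryGroup hQm) hY hY' hX hX' hYY hYY' hXX hXX' ha hc
      (hswap h₁) (hswap h₃)
    -- A second swap undoes the first, at the cost of exchanging the left local factors `A` and `B`.
    refine ⟨_, swapOp_mul_mem_cliffordGroupTwo hmem, B, hB, A, hA, R, hR, S, hS, ?_⟩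
    rw [mul_assoc (B ⊗ₖ A), ← hright]
    calc swapOp * ((A ⊗ₖ B) * (swapOp * Q) * ((1 : OneQubitOp) ⊗ₖ S))
        = (swapOp * (A ⊗ₖ B)) * swapOp * (Q * ((1 : OneQubitOp) ⊗ₖ S)) := by
          simp only [mul_assoc]
      _ = _ := by
          rw [swapOp_mul_kronecker, mul_assoc (B ⊗ₖ A), swapOp_mul_self, mul_one]

open Matrix in
theorem mem_familyL_of_locallyEquivalent {U C : TwoQubitOp}
    (hU : U ∈ unitaryGroup (Fin 2 × Fin 2) ℂ) (hC : C ∈ cliffordGroupTwo)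
    (h : LocallyEquivalent U C) : U ∈ familyL := by
  obtain ⟨R₁, hR₁, S₁, hS₁, R₂, hR₂, S₂, hS₂, rfl⟩ := h
  -- `S₂` cancels on the identity factor, so the right-hand rotation `R₂` serves as `R`; the phase
  -- `c` goes into the first factor.
  refine ⟨hU, R₂, hR₂, fun j _ => ?_⟩
  obtain ⟨c, hc, k, l, h⟩ := hC.2 _ (kronecker_mem_pauliGroupTwo j 0)
  have hcu : star c * c = 1 := by
    simp only [Set.mem_insert_iff, Set.mem_singleton_iff] at hc
    rcases hc with rfl | rfl | rfl | rfl <;> simp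
  have h2 : (R₂ ⊗ₖ S₂) * (pauli j ⊗ₖ pauli 0) * star (R₂ ⊗ₖ S₂) =
      (R₂ * pauli j * star R₂) ⊗ₖ (1 : OneQubitOp) := by
    rw [star_kronecker, ← mul_kronecker_mul, ← mul_kronecker_mul, pauli_zero, mul_one,
      mem_unitaryGroup_iff.1 hS₂]
  have hL := kronecker_mem_unitaryGroup hR₁ hS₁
  have h3 := conj_conj hL (A := c • (pauli k ⊗ₖ pauli l))
    (B := U * ((R₂ * pauli j * star R₂) ⊗ₖ (1 : OneQubitOp)) * star U) (by
      rw [← h, ← h2, star_mul, star_mul]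
      simp only [mul_assoc])
  refine ⟨c • (star R₁ * pauli k * R₁), smul_mem_unitaryGroup hcu
    (mul_mem (mul_mem (Unitary.star_mem hR₁) (pauli_mem_unitaryGroup k)) hR₁),
    star S₁ * pauli l * S₁,
    mul_mem (mul_mem (Unitary.star_mem hS₁) (pauli_mem_unitaryGroup l)) hS₁, ?_⟩
  rw [h3, star_kronecker, mul_smul_comm, smul_mul_assoc, ← mul_kronecker_mul, ← mul_kronecker_mul,
    smul_kronecker]

theorem lemma1 (U : TwoQubitOp) (hU : U ∈ Matrix.unitaryGroup (Fin 2 × Fin 2) ℂ) :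
    U ∈ familyL ↔ ∃ C ∈ cliffordGroupTwo, LocallyEquivalent U C :=
  ⟨exists_mem_cliffordGroupTwo_of_mem_familyL,
    fun ⟨_, hC, h⟩ => mem_familyL_of_locallyEquivalent hU hC h⟩
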